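/- Let $E$ be a nonzero real Banach space with dual $E^*$ and bidual $E^{**}$, and let $x\mapsto\hat x$ be the canonical embedding of $E$ in $E^{**}$. Norm $E\times E^*$ by $\|(x,x^*)\|:=\sqrt{\|x\|^2+\|x^*\|^2}$, and write $r(x,x^*):=\tfrac12\|x\|^2+\tfrac12\|x^*\|^2+\langle x,x^*\rangle$ and $L(x,x^*):=(x^*,\hat x)\in E^*\times E^{**}$. A set $A\subset E\times E^*$ is *quasidense* if $\inf_{a\in A}r(a-c)\le 0$ for all $c\in E\times E^*$, and *stably quasidense* if for all $c\in E\times E^*$ there is $K_c\ge 0$ with $\inf\{r(a-c):a\in A,\ \|a-c\|\le K_c\}\le 0$ (with $\inf\emptyset=\infty$). A multifunction $S:E\rightrightarrows E^*$ with graph $G(S)=\{(x,x^*):x^*\in S(x)\}$ and range $R(S)=\bigcup_{x\in E}S(x)$ is *closed*, *quasidense* or *stably quasidense* if $G(S)$ is (norm-)closed, quasidense or stably quasidense in $E\times E^*$, respectively, and *monotone* if $\langle x-y,x^*-y^*\rangle\ge0$ for all $(x,x^*),(y,y^*)\in G(S)$. The Fitzpatrick function of $S$ is $\varphi_S(x,x^*):=\sup_{(s,s^*)\in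 G(S)}[\langle s,x^*\rangle+\langle x,s^*\rangle-\langle s,s^*\rangle]$, with conjugate $\varphi_S^*(y^*,y^{**}):=\sup_{(x,x^*)\in E\times E^*}[\langle x,y^*\rangle+\langle x^*,y^{**}\rangle-\varphi_S(x,x^*)]$; $\operatorname{dom}\varphi_S$ is the set where $\varphi_S$ is finite, and $\pi_2(x,x^*):=x^*$. For $S$ closed, monotone and quasidense, its *Fitzpatrick extension* is the multifunction $S^{\mathbb F}:E^*\rightrightarrows E^{**}$ with graph $G(S)^{\mathbb F}:=\{(y^*,y^{**})\in E^*\times E^{**}:\varphi_S^*(y^*,y^{**})=\langle y^*,y^{**}\rangle\}$. Sums of multifunctions are pointwise Minkowski sums, inverses of multifunctions are set-valued, and $S\parallel T:=(S^{-1}+T^{-1})^{-1}$ is the *parallel sum*. **Theorem.** Let $S,T:E\rightrightarrows E^*$ be closed, monotone and quasidense. Then (a) $\Rightarrow$ (b) $\Rightarrow$ (c) $\Rightarrow$ (d) $\Rightarrow$ (e), where: (a) $R(S)\cap\operatorname{int}R(T)\ne\emptyset$ or $\operatorname{int}R(S)\cap R(T)\ne\emptyset$. (b) $\bigcup_{\lambda>0}\lambda[R(S)-R(T)]=E^*$.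 (c) $\bigcup_{\lambda>0}\lambda[\pi_2\operatorname{dom}\varphi_S-\pi_2\operatorname{dom}\varphi_T]$ is a closed linear subspace of $E^*$. (d) The multifunction $P:E\rightrightarrows E^*$ defined by $P(y):=(S^{\mathbb F}+T^{\mathbb F})^{-1}(\hat y)$ is closed, monotone and stably quasidense. (e) If, further, $G(T)^{\mathbb F}=L(G(T))$, then $S\parallel T$ is closed, monotone and stably quasidense. -/

import Mathlib

open scoped Pointwise

namespace QuasidenseSum

/-- A multifunction `X ⇉ Y`. -/
abbrev Multi (X Y : Type*) := X → Set Y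

namespace Multi

variable {X Y : Type*}

/-- The graph `G(S)`. -/
def graph (S : Multi X Y) : Set (X × Y) := {p | p.2 ∈ S p.1}

/-- The range `R(S)`. -/
def range (S : Multi X Y) : Set Y := {y | ∃ x, y ∈ S x}

/-- The inverse multifunction `S⁻¹`. -/
def inverse (S : Multi X Y) : Multi Y X := fun y => {x | y ∈ S x}

/-- The pointwise (Minkowski) sum, `x ↦ S x + T x`. -/
def sum [Add Y] (S T : Multi X Y) : Multi X Y := fun x => S x + T x

/-- The parallel sum `S ‖ T = (S⁻¹ + T⁻¹)⁻¹`. -/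
def parallelSum [Add X] (S T : Multi X Y) : Multi X Y :=
  (S.inverse.sum T.inverse).inverse

end Multi

/-- The effective domain of an extended-real-valued function. -/
def effDom {X : Type*} (f : X → EReal) : Set X := {x | ∃ r : ℝ, f x = (r : EReal)}

/-- The cone `⋃_{t > 0} t (A - B)`. -/
def diffCone {X : Type*} [AddCommGroup X] [Module ℝ X] (A B : Set X) : Set X :=
  ⋃ (t : ℝ) (_ : 0 < t), t • (A - B)

/-- The set `A` is (the carrier of) a closed linear subspace. -/
def IsClosedSubspace {X : Type*} [NormedAddCommGroup X] [NormedSpace ℝ X] (A : Set X) : Prop :=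
  IsClosed A ∧ ∃ V : Submodule ℝ X, (V : Set X) = A

section Banach

variable {E : Type*} [NormedAddCommGroup E] [NormedSpace ℝ E]

/-- The pairing between `E × E*` and `E* × E**`. -/
noncomputable def pairing (b : E × StrongDual ℝ E) (d : StrongDual ℝ E × StrongDual ℝ (StrongDual ℝ E)) : ℝ :=
  d.1 b.1 + d.2 b.2

/-- The canonical map `L (x, x*) = (x*, x̂)` from `E × E*` to `E* × E**`. -/
noncomputable def mapL (b : E × StrongDual ℝ E) :
    StrongDual ℝ E × StrongDual ℝ (StrongDual ℝ E) :=
  (b.2, NormedSpace.inclusionInDoubleDual ℝ E b.1)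

/-- The duality form `q (x, x*) = ⟨x, x*⟩`, on `E × E*`; applied with `E*` in place of `E`
it is the corresponding form on `E* × E**`. -/
noncomputable def qForm (b : E × StrongDual ℝ E) : ℝ := b.2 b.1

/-- The norm `√(‖x‖² + ‖x*‖²)` of `E × E*`. -/
noncomputable def hilbertNorm (b : E × StrongDual ℝ E) : ℝ := √(‖b.1‖ ^ 2 + ‖b.2‖ ^ 2)

/-- `r (b) = ½ ‖b‖² + q (b)`. -/
noncomputable def rForm (b : E × StrongDual ℝ E) : ℝ := 1 / 2 * hilbertNorm b ^ 2 + qForm b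

/-- Quasidensity of a subset of `E × E*`. The infimum is taken in the extended reals, so that
the infimum over the empty set is `∞`. -/
def IsQuasidenseSet (A : Set (E × StrongDual ℝ E)) : Prop :=
  ∀ c, (⨅ a ∈ A, (rForm (a - c) : EReal)) ≤ 0

/-- Stable quasidensity of a subset of `E × E*`: near-minimizers can be found within a
distance of `c` that depends only on `c`. -/
def IsStablyQuasidenseSet (A : Set (E × StrongDual ℝ E)) : Prop :=
  ∀ c, ∃ K : ℝ, 0 ≤ K ∧
    (⨅ a ∈ {a ∈ A | hilbertNorm (a - c) ≤ K}, (rForm (a - c) : EReal)) ≤ 0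

/-- The Fitzpatrick function `Φ_A (b) = sup_{a ∈ A} [⟨a, L b⟩ - q (a)]`. -/
noncomputable def fitz (A : Set (E × StrongDual ℝ E)) (b : E × StrongDual ℝ E) : EReal :=
  ⨆ a ∈ A, ((pairing a (mapL b) - qForm a : ℝ) : EReal)

/-- The Fenchel conjugate on `E* × E**` of an extended-real-valued function on `E × E*`. -/
noncomputable def conj (f : E × StrongDual ℝ E → EReal)
    (d : StrongDual ℝ E × StrongDual ℝ (StrongDual ℝ E)) : EReal :=
  ⨆ b, ((pairing b d : ℝ) : EReal) - f b

/-- The Fitzpatrick extension `A^𝔽 = {d ∈ E* × E** : Φ_A^* (d) = q (d)}`. -/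
def fitzExt (A : Set (E × StrongDual ℝ E)) :
    Set (StrongDual ℝ E × StrongDual ℝ (StrongDual ℝ E)) :=
  {d | conj (fitz A) d = (qForm d : EReal)}

namespace Multi

/-- `S` is closed: its graph is norm-closed in `E × E*`. -/
def Closed (S : Multi E (StrongDual ℝ E)) : Prop := IsClosed S.graph

/-- `S` is monotone. -/
def IsMonotone (S : Multi E (StrongDual ℝ E)) : Prop :=
  ∀ a ∈ S.graph, ∀ b ∈ S.graph, 0 ≤ qForm (a - b)

/-- `S` is quasidense. -/
def Quasidense (S : Multi E (StrongDual ℝ E)) : Prop := IsQuasidenseSet S.graph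

/-- `S` is stably quasidense. -/
def StablyQuasidense (S : Multi E (StrongDual ℝ E)) : Prop := IsStablyQuasidenseSet S.graph

/-- The multifunction `S^𝔽 : E* ⇉ E**` whose graph is the Fitzpatrick extension of `G(S)`. -/
def fitzExtension (S : Multi E (StrongDual ℝ E)) :
    Multi (StrongDual ℝ E) (StrongDual ℝ (StrongDual ℝ E)) :=
  fun y => {z | (y, z) ∈ fitzExt S.graph}

/-- The multifunction `y ↦ (S^𝔽 + T^𝔽)⁻¹ (ŷ)` from `E` to `E*`. -/
noncomputable def extendedParallelSum (S T : Multi E (StrongDual ℝ E)) :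
    Multi E (StrongDual ℝ E) :=
  fun y => (S.fitzExtension.sum T.fitzExtension).inverse
    (NormedSpace.inclusionInDoubleDual ℝ E y)

end Multi

end Banach

end QuasidenseSum

open QuasidenseSum

/-! Extended-valued functions are replaced by convex sets `C` of points above their graphs. If the
function `f` generated by `C` satisfies `f ≥ q`, and its conjugate satisfies `f* ≥ q` on `E* × E**`
(`IsRepresentative`), then `{b | f* (L b) ≤ q b}` is closed, monotone and, when `E` is complete,
stably quasidense. The engine is `exists_gap_add_rForm_le`: by Hahn–Banach, `(f - q)(b) + r (b - c)`
can be made arbitrarily small. Iterating this gives a Cauchy sequence whose limit lies in the set,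
at a distance controlled by the initial gap `f - q`.

Fitzpatrick functions of monotone quasidense sets are such representatives. Under (c), so is the
partial inf-convolution of `φ_S` and `φ_T` in the first variable: an Attouch–Brezis multiplier
splits its conjugate exactly as `φ_S* (y*, v) + φ_T* (y*, y** - v)`. As each conjugate dominates `q`
and `q` is additive over this split, equality for the sum forces equality in both terms. So the set
attached to the inf-convolution is the graph of `P`, which proves (d). For (e), the extra hypothesis
makes `P` coincide with `S ∥ T`. -/

/-! ### Separation and almost aligned vectors. -/

/-- Hahn–Banach sandwich theorem: an affine function separates a continuous concave function from
a convex set of points above its graph. -/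
theorem exists_affine_between {Y : Type*} [NormedAddCommGroup Y] [NormedSpace ℝ Y]
    {C : Set (Y × ℝ)} (hC : Convex ℝ C) (hne : C.Nonempty) {p : Y → ℝ}
    (hp : ConcaveOn ℝ Set.univ p) (hpc : Continuous p) (h : ∀ z ∈ C, p z.1 ≤ z.2) :
    ∃ (d : StrongDual ℝ Y) (α : ℝ), (∀ y, p y ≤ d y + α) ∧ ∀ z ∈ C, d z.1 + α ≤ z.2 := by
  have hconv : Convex ℝ {z : Y × ℝ | z.2 < p z.1} := by
    have := hp.convex_strict_hypograph
    simpa using this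
  have hopen : IsOpen {z : Y × ℝ | z.2 < p z.1} :=
    isOpen_lt continuous_snd (hpc.comp continuous_fst)
  have hdisj : Disjoint {z : Y × ℝ | z.2 < p z.1} C := by
    rw [Set.disjoint_left]
    intro z hz hzC
    exact absurd (h z hzC) (not_le.mpr hz)
  obtain ⟨f, u, hf, hu⟩ := geometric_hahn_banach_open hconv hopen hC hdisj
  have split : ∀ y t, f (y, t) = f (y, 0) + t * f (0, 1) := by
    intro y t
    have : ((y, t) : Y × ℝ) = (y, 0) + t • (0, 1) := by simp
    rw [this, map_add, map_smul, smul_eq_mul]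
  set τ := f (0, 1) with hτ
  have hle : ∀ y, f (y, 0) + p y * τ ≤ u := by
    intro y
    refine le_of_forall_pos_le_add fun ε hε => ?_
    have hpos : 0 < |τ| + 1 := by positivity
    have h1 := hf (y, p y - ε / (|τ| + 1)) (by
      change p y - ε / (|τ| + 1) < p y
      have : 0 < ε / (|τ| + 1) := by positivity
      linarith)
    rw [split] at h1
    have h2 : ε / (|τ| + 1) * τ ≤ ε := by
      rw [div_mul_eq_mul_div, div_le_iff₀ hpos]
      have := le_abs_self τ
      nlinarith
    nlinarith
  have hτ0 : 0 ≤ τ := by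
    by_contra hneg
    push Not at hneg
    have h0 := hf (0, min (p 0 - 1) (u / τ)) (by
      change min (p 0 - 1) (u / τ) < p 0
      exact lt_of_le_of_lt (min_le_left _ _) (by linarith))
    rw [split] at h0
    have h1 : f ((0 : Y), (0 : ℝ)) = 0 := map_zero f
    have h2 := mul_le_mul_of_nonpos_right (min_le_right (p 0 - 1) (u / τ)) hneg.le
    rw [div_mul_cancel₀ _ hneg.ne] at h2
    linarith
  -- The hyperplane is not vertical: as `p` is finite everywhere, `τ = 0` would bound `f (·, 0)`
  -- above on all of `Y`, making it nonpositive, whereas `u > 0` bounds `f` below on `C`.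
  have hτ1 : 0 < τ := by
    refine lt_of_le_of_ne hτ0 fun h0 => ?_
    have hlt : ∀ y, f (y, 0) < u := by
      intro y
      have := hf (y, p y - 1) (by change p y - 1 < p y; linarith)
      rw [split, ← h0] at this
      linarith
    have hu0 : 0 < u := (map_zero f).symm.trans_lt (hlt 0)
    have hz : ∀ y, f (y, 0) ≤ 0 := by
      intro y
      by_contra hpos
      push Not at hpos
      have := hlt ((u / f (y, 0)) • y)
      have e : (((u / f (y, 0)) • y, 0) : Y × ℝ) = (u / f (y, 0)) • (y, 0) := by simp
      rw [e, map_smul, smul_eq_mul, div_mul_cancel₀ _ hpos.ne'] at this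
      exact lt_irrefl _ this
    obtain ⟨z, hz'⟩ := hne
    have h1 := hu z hz'
    have h2 := split z.1 z.2
    rw [← h0] at h2
    have := hz z.1
    simp only [Prod.mk.eta] at h2
    linarith
  refine ⟨-(τ⁻¹ • f.comp (ContinuousLinearMap.inl ℝ Y ℝ)), u / τ, fun y => ?_, fun z hz => ?_⟩
  · have := hle y
    simp only [neg_apply, smul_apply,
      ContinuousLinearMap.comp_apply, ContinuousLinearMap.inl_apply, smul_eq_mul]
    have e : -(τ⁻¹ * f (y, 0)) + u / τ = (u - f (y, 0)) / τ := by field_simp; ring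
    rw [e, le_div_iff₀ hτ1]
    linarith
  · have := hu z hz
    have h2 := split z.1 z.2
    simp only [Prod.mk.eta] at h2
    simp only [neg_apply, smul_apply,
      ContinuousLinearMap.comp_apply, ContinuousLinearMap.inl_apply, smul_eq_mul]
    have e : -(τ⁻¹ * f (z.1, 0)) + u / τ = (u - f (z.1, 0)) / τ := by field_simp; ring
    rw [e, div_le_iff₀ hτ1]
    linarith

/-- Every functional is almost aligned with a vector of almost the same norm. -/
theorem exists_almost_aligned {X : Type*} [NormedAddCommGroup X] [NormedSpace ℝ X]
    (φ : StrongDual ℝ X) {ε : ℝ} (hε : 0 < ε) :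
    ∃ x, 1 / 2 * ‖x‖ ^ 2 + 1 / 2 * ‖φ‖ ^ 2 - ε ≤ φ x := by
  have hpos : 0 < ‖φ‖ + 1 := by positivity
  obtain ⟨x, hx1, hx2⟩ : ∃ x : X, ‖x‖ ≤ 1 ∧ ‖φ‖ - ε / (‖φ‖ + 1) ≤ φ x := by
    by_contra hcon
    push Not at hcon
    by_cases hs : 0 ≤ ‖φ‖ - ε / (‖φ‖ + 1)
    · have : ‖φ‖ ≤ ‖φ‖ - ε / (‖φ‖ + 1) := by
        refine ContinuousLinearMap.opNorm_le_of_unit_norm hs fun x hx => ?_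
        rw [Real.norm_eq_abs, abs_le]
        have h1 := hcon x hx.le
        have h2 := hcon (-x) (by rw [norm_neg]; exact hx.le)
        rw [map_neg] at h2
        constructor <;> linarith
      have : 0 < ε / (‖φ‖ + 1) := by positivity
      linarith
    · have := hcon 0 (by simp)
      rw [map_zero] at this
      linarith
  -- Scaling a nearly norming vector by `‖φ‖` makes `φ` nearly `‖φ‖ ^ 2`, while both half-squares
  -- are at most `‖φ‖ ^ 2 / 2`.
  refine ⟨‖φ‖ • x, ?_⟩
  rw [norm_smul, norm_norm, map_smul, smul_eq_mul]
  have h1 : ‖φ‖ * ‖x‖ ≤ ‖φ‖ := by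
    have := norm_nonneg φ
    nlinarith
  have h2 : (‖φ‖ * ‖x‖) ^ 2 ≤ ‖φ‖ ^ 2 := by
    apply pow_le_pow_left₀ (by positivity) h1
  have h3 := mul_le_mul_of_nonneg_left hx2 (norm_nonneg φ)
  have h4 : ‖φ‖ * (ε / (‖φ‖ + 1)) ≤ ε := by
    rw [mul_div_assoc', div_le_iff₀ hpos]
    nlinarith
  nlinarith

/-! ### Open mapping for convex sets and Lagrange multipliers. -/

section ConstraintQualification

variable {X Y : Type*} [NormedAddCommGroup X] [NormedSpace ℝ X]
  [NormedAddCommGroup Y] [NormedSpace ℝ Y]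

/-- The weights sum to less than one, and `0 ∈ U` absorbs the rest. Inductively, the sum is the
midpoint of `u 0` and the same sum for the shifted sequence. -/
theorem sum_geometric_mem {U : Set X} (hU : Convex ℝ U) (h0 : (0 : X) ∈ U) (n : ℕ) :
    ∀ u : ℕ → X, (∀ k, u k ∈ U) → ∑ k ∈ Finset.range n, ((1 / 2 : ℝ) ^ (k + 1)) • u k ∈ U := by
  induction n with
  | zero => intro u _; simpa using h0
  | succ n ih =>
    intro u hu
    rw [Finset.sum_range_succ']
    have h1 := ih (fun k => u (k + 1)) fun k => hu _
    have h2 := hU h1 (hu 0) (a := 1 / 2) (b := 1 / 2) (by norm_num) (by norm_num) (by norm_num)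
    rw [Finset.smul_sum] at h2
    convert h2 using 2
    · refine Finset.sum_congr rfl fun k _ => ?_
      rw [smul_smul]; congr 1; ring
    · norm_num

/-- For a bounded closed convex set containing `0` in a Banach space, a ball in the closure of its
image under a continuous linear map yields a ball in the image itself. -/
theorem mem_image_of_ball_subset_closure [CompleteSpace X] {U : Set X} (hU : Convex ℝ U)
    (hUc : IsClosed U) (h0 : (0 : X) ∈ U) (hUb : ∀ u ∈ U, ‖u‖ ≤ 1) (A : X →L[ℝ] Y)
    {Z : Submodule ℝ Y} (hAZ : ∀ u ∈ U, A u ∈ Z) {r : ℝ} (hr : 0 < r)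
    (hball : ∀ z ∈ Z, ‖z‖ ≤ r → z ∈ closure (A '' U)) {z : Y} (hz : z ∈ Z) (hzr : ‖z‖ ≤ r / 2) :
    z ∈ A '' U := by
  have step : ∀ z : {z : Y // z ∈ Z ∧ ‖z‖ ≤ r / 2}, ∃ u ∈ U, ‖(2 : ℝ) • z.1 - A u‖ ≤ r / 2 := by
    rintro ⟨z, hz, hzr⟩
    have h := hball ((2 : ℝ) • z) (Z.smul_mem _ hz) (by
      rw [norm_smul, Real.norm_eq_abs, abs_two]; linarith)
    obtain ⟨y, ⟨u, hu, rfl⟩, hy⟩ := Metric.mem_closure_iff.mp h (r / 2) (by positivity)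
    exact ⟨u, hu, by rw [← dist_eq_norm]; exact hy.le⟩
  choose g hgU hg using step
  -- The residual is doubled at each stage and stays within `r / 2`, so the iteration continues;
  -- undoing the doublings gives `z = ∑ 2⁻⁽ᵏ⁺¹⁾ A (u k)`.
  let next : {z : Y // z ∈ Z ∧ ‖z‖ ≤ r / 2} → {z : Y // z ∈ Z ∧ ‖z‖ ≤ r / 2} := fun z =>
    ⟨(2 : ℝ) • z.1 - A (g z), Z.sub_mem (Z.smul_mem _ z.2.1) (hAZ _ (hgU z)), hg z⟩
  let ζ : ℕ → {z : Y // z ∈ Z ∧ ‖z‖ ≤ r / 2} := fun n => next^[n] ⟨z, hz, hzr⟩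
  have hζ : ∀ n, (ζ (n + 1)).1 = (2 : ℝ) • (ζ n).1 - A (g (ζ n)) := by
    intro n
    simp only [ζ, Function.iterate_succ_apply']
    rfl
  let u : ℕ → X := fun n => g (ζ n)
  have hu : ∀ n, u n ∈ U := fun n => hgU _
  have hgeo : Summable fun k : ℕ => (1 / 2 : ℝ) ^ (k + 1) :=
    (summable_nat_add_iff 1).mpr (summable_geometric_of_lt_one (by norm_num) (by norm_num))
  have hsum : Summable fun k : ℕ => ((1 / 2 : ℝ) ^ (k + 1)) • u k := by
    refine Summable.of_norm_bounded hgeo fun k => ?_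
    rw [norm_smul, Real.norm_of_nonneg (by positivity)]
    exact mul_le_of_le_one_right (by positivity) (hUb _ (hu k))
  have hlim := hsum.hasSum.tendsto_sum_nat
  refine ⟨_, hUc.mem_of_tendsto hlim
    (Filter.Eventually.of_forall fun n => sum_geometric_mem hU h0 n u hu), ?_⟩
  have hpart : ∀ n, A (∑ k ∈ Finset.range n, ((1 / 2 : ℝ) ^ (k + 1)) • u k)
      = z - ((1 / 2 : ℝ) ^ n) • (ζ n).1 := by
    intro n
    induction n with
    | zero => simp [ζ]
    | succ n ih =>
      rw [Finset.sum_range_succ, map_add, ih, hζ, map_smul, smul_sub, smul_smul]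
      have : (1 / 2 : ℝ) ^ (n + 1) * 2 = (1 / 2) ^ n := by rw [pow_succ]; ring
      rw [this]
      simp only [u]
      abel
  have h1 := (A.continuous.tendsto _).comp hlim
  have h2 : Filter.Tendsto (fun n => z - ((1 / 2 : ℝ) ^ n) • (ζ n).1) Filter.atTop
      (nhds (z - 0)) := by
    refine tendsto_const_nhds.sub ?_
    refine squeeze_zero_norm (a := fun n => (1 / 2 : ℝ) ^ n * (r / 2)) (fun n => ?_) ?_
    · rw [norm_smul, Real.norm_of_nonneg (by positivity)]
      exact mul_le_mul_of_nonneg_left (ζ n).2.2 (by positivity)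
    · simpa using (tendsto_pow_atTop_nhds_zero_of_lt_one (r := (1 / 2 : ℝ)) (by norm_num)
        (by norm_num)).mul_const (r / 2)
  rw [sub_zero] at h2
  refine tendsto_nhds_unique h1 (h2.congr fun n => ?_)
  rw [← hpart]; rfl

/-- If the cone generated by the image of a closed convex set `W ∋ 0` is a complete subspace, then
the image of the part of `W` in the unit ball contains a ball of that subspace. -/
theorem exists_ball_subset_image [CompleteSpace X] {W : Set X} (hW : Convex ℝ W)
    (hWc : IsClosed W) (h0 : (0 : X) ∈ W) (A : X →L[ℝ] Y) {Z : Submodule ℝ Y}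
    (hZc : IsComplete (Z : Set Y)) (hAZ : ∀ w ∈ W, A w ∈ Z)
    (hcone : ∀ z ∈ Z, ∃ t : ℝ, 0 < t ∧ ∃ w ∈ W, z = t • A w) :
    ∃ r : ℝ, 0 < r ∧ ∀ z ∈ Z, ‖z‖ ≤ r → ∃ w ∈ W, ‖w‖ ≤ 1 ∧ A w = z := by
  set U := W ∩ Metric.closedBall 0 1 with hUdef
  have hU : Convex ℝ U := hW.inter (convex_closedBall _ _)
  have hUc : IsClosed U := hWc.inter Metric.isClosed_closedBall
  have hU0 : (0 : X) ∈ U := ⟨h0, by simp⟩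
  have habs : ∀ z ∈ Z, ∃ t : ℝ, 0 < t ∧ ∀ s, t ≤ s → ∃ u ∈ U, z = s • A u := by
    intro z hz
    obtain ⟨t, ht, w, hw, rfl⟩ := hcone z hz
    have hm : 0 < max 1 ‖w‖ := lt_of_lt_of_le one_pos (le_max_left _ _)
    refine ⟨t * max 1 ‖w‖, by positivity, fun s hs => ?_⟩
    have hs0 : 0 < s := lt_of_lt_of_le (by positivity) hs
    have hts : t ≤ s := le_trans (le_mul_of_one_le_right ht.le (le_max_left _ _)) hs
    refine ⟨(t / s) • w, ⟨?_, ?_⟩, ?_⟩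
    · have := hW hw h0 (a := t / s) (b := 1 - t / s) (by positivity)
        (by rw [sub_nonneg, div_le_one hs0]; exact hts) (by ring)
      simpa using this
    · rw [mem_closedBall_zero_iff, norm_smul, Real.norm_of_nonneg (by positivity),
        div_mul_eq_mul_div, div_le_one hs0]
      exact le_trans (mul_le_mul_of_nonneg_left (le_max_right _ _) ht.le) hs
    · rw [map_smul, smul_smul, mul_div_cancel₀ _ hs0.ne']
  have : CompleteSpace Z := hZc.completeSpace_coe
  let T : Set Z := {z | (z : Y) ∈ closure (A '' U)}
  have hTc : IsClosed T := isClosed_closure.preimage continuous_subtype_val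
  have hTconv : Convex ℝ T :=
    ((hU.linear_image A.toLinearMap).closure).linear_preimage Z.subtype
  -- Baire category in the complete space `Z`.
  have hcover : ⋃ n : ℕ, ((n : ℝ) + 1) • T = Set.univ := by
    refine Set.eq_univ_of_forall fun z => ?_
    obtain ⟨t, ht, h⟩ := habs z z.2
    obtain ⟨n, hn⟩ := exists_nat_ge t
    obtain ⟨u, hu, hzu⟩ := h (n + 1) (by linarith)
    refine Set.mem_iUnion.mpr ⟨n, ⟨A u, hAZ u hu.1⟩, subset_closure ⟨u, hu, rfl⟩, ?_⟩
    exact Subtype.ext hzu.symm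
  obtain ⟨n, hn⟩ := nonempty_interior_of_iUnion_of_closed
    (fun n : ℕ => hTc.smul_of_ne_zero (c := (n : ℝ) + 1) (by positivity)) hcover
  have hn0 : ((n : ℝ) + 1) ≠ 0 := by positivity
  rw [interior_smul₀ hn0] at hn
  obtain ⟨_, z₀, hz₀, -⟩ := hn
  -- Since `-z₀ = t • A u` with `A u ∈ T`, the origin is a convex combination of the interior point
  -- `z₀` and `A u`, hence is itself interior.
  obtain ⟨t, ht, h⟩ := habs (-z₀ : Z) (-z₀).2
  obtain ⟨u, hu, hzu⟩ := h t le_rfl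
  have hmem : (0 : Z) ∈ interior T := by
    have hy : (⟨A u, hAZ u hu.1⟩ : Z) ∈ T := subset_closure ⟨u, hu, rfl⟩
    have hcomb := hTconv.combo_interior_self_mem_interior hz₀ hy (a := 1 / (1 + t))
      (b := t / (1 + t)) (by positivity) (by positivity) (by field_simp)
    convert hcomb using 1
    apply Subtype.ext
    have e : (z₀ : Y) = -(t • A u) := by rw [← hzu]; simp
    simp only [Submodule.coe_zero, Submodule.coe_add, Submodule.coe_smul, e, smul_neg, smul_smul]
    rw [one_div, div_eq_inv_mul]
    simp
  obtain ⟨r, hr, hball⟩ := Metric.mem_nhds_iff.mp (mem_interior_iff_mem_nhds.mp hmem)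
  -- One halving passes from an open to a closed ball, the other removes the closure.
  refine ⟨r / 2 / 2, by positivity, fun z hz hzr => ?_⟩
  obtain ⟨w, hw, rfl⟩ := mem_image_of_ball_subset_closure hU hUc hU0
    (fun u hu => by simpa using hu.2) A (fun u hu => hAZ u hu.1) (half_pos hr)
    (fun z hz hzr => hball (show (⟨z, hz⟩ : Z) ∈ Metric.ball 0 r by
      rw [mem_ball_zero_iff]; exact lt_of_le_of_lt hzr (by linarith))) hz hzr
  exact ⟨w, hw.1, by simpa using hw.2, rfl⟩

/-- Lagrange multipliers for a linear objective on a closed convex set with linear constraint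
`A w = 0`, under the Attouch–Brezis constraint qualification. -/
theorem exists_lagrange_multiplier [CompleteSpace X] {W : Set X} (hW : Convex ℝ W)
    (hWc : IsClosed W) (A : X →L[ℝ] Y) {Z : Submodule ℝ Y} (hZc : IsComplete (Z : Set Y))
    (hAZ : ∀ w ∈ W, A w ∈ Z) (hcone : ∀ z ∈ Z, ∃ t : ℝ, 0 < t ∧ ∃ w ∈ W, z = t • A w)
    (φ : StrongDual ℝ X) {m : ℝ} (hm : ∀ w ∈ W, A w = 0 → m ≤ φ w) :
    ∃ v : StrongDual ℝ Y, ∀ w ∈ W, m ≤ φ w + v (A w) := by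
  obtain ⟨t, ht, w₀, hw₀, hz₀⟩ := hcone 0 Z.zero_mem
  have hA₀ : A w₀ = 0 := by
    rcases smul_eq_zero.mp hz₀.symm with h | h
    · exact absurd h ht.ne'
    · exact h
  obtain ⟨r, hr, hball⟩ := exists_ball_subset_image (W := (fun w => w + w₀) ⁻¹' W)
    (hW.translate_preimage_left w₀) (hWc.preimage (by fun_prop)) (by simpa using hw₀) A hZc
    (fun w hw => by simpa [hA₀] using hAZ _ hw)
    (fun z hz => by
      obtain ⟨t, ht, w, hw, h⟩ := hcone z hz
      exact ⟨t, ht, w - w₀, by simpa using hw, by simpa [hA₀] using h⟩)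
  have hball' : ∀ z ∈ Z, ‖z‖ ≤ r → ∃ w ∈ W, ‖w‖ ≤ 1 + ‖w₀‖ ∧ A w = z := by
    intro z hz hzr
    obtain ⟨w, hw, hw1, rfl⟩ := hball z hz hzr
    exact ⟨w + w₀, hw, (norm_add_le _ _).trans (by linarith), by simp [hA₀]⟩
  set c := (|m| + ‖φ‖ * (1 + ‖w₀‖)) / r with hc
  have hc0 : 0 ≤ c := by positivity
  -- The optimal value falls at most linearly in `‖A w‖`: mixing `w` with a bounded `w'` whose image
  -- points the opposite way gives a feasible point. The sandwich theorem then turns this bound into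
  -- a multiplier.
  have hlow : ∀ w ∈ W, m - c * ‖A w‖ ≤ φ w := by
    intro w hw
    by_cases hz : A w = 0
    · simpa [hz] using hm w hw hz
    have hzn : 0 < ‖A w‖ := norm_pos_iff.mpr hz
    obtain ⟨w', hw', hn', hA'⟩ := hball' (-(r / ‖A w‖) • A w) (Z.smul_mem _ (hAZ w hw)) (by
      rw [norm_smul, norm_neg, Real.norm_of_nonneg (by positivity), div_mul_cancel₀ _ hzn.ne'])
    have hs : 0 < r + ‖A w‖ := by positivity
    have hmem := hW hw hw' (a := r / (r + ‖A w‖)) (b := ‖A w‖ / (r + ‖A w‖)) (by positivity)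
      (by positivity) (by field_simp)
    have h1 := hm _ hmem (by
      rw [map_add, map_smul, map_smul, hA', smul_smul, ← add_smul]
      have : r / (r + ‖A w‖) + ‖A w‖ / (r + ‖A w‖) * -(r / ‖A w‖) = 0 := by field_simp; ring
      rw [this, zero_smul])
    rw [map_add, map_smul, map_smul, smul_eq_mul, smul_eq_mul, div_mul_eq_mul_div,
      div_mul_eq_mul_div, ← add_div, le_div_iff₀ hs] at h1
    have h2 : φ w' ≤ ‖φ‖ * (1 + ‖w₀‖) :=
      (le_abs_self _).trans ((φ.le_opNorm w').trans
        (mul_le_mul_of_nonneg_left hn' (norm_nonneg _)))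
    have h3 : c * r = |m| + ‖φ‖ * (1 + ‖w₀‖) := div_mul_cancel₀ _ hr.ne'
    have h4 := neg_abs_le m
    have h5 : ‖A w‖ * (φ w' - m) ≤ ‖A w‖ * (c * r) :=
      mul_le_mul_of_nonneg_left (by linarith) hzn.le
    have h6 : r * (m - c * ‖A w‖) ≤ r * φ w := by nlinarith
    exact le_of_mul_le_mul_left h6 hr
  obtain ⟨d, α, h1, h2⟩ := exists_affine_between (C := (fun w => (A w, φ w)) '' W)
    (p := fun y => m - c * ‖y‖)
    (hW.linear_image (A.toLinearMap.prod φ.toLinearMap)) ⟨_, w₀, hw₀, rfl⟩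
    ((concaveOn_const m convex_univ).sub ((convexOn_univ_norm (E := Y)).smul hc0))
    (by fun_prop) (by rintro _ ⟨w, hw, rfl⟩; exact hlow w hw)
  refine ⟨-d, fun w hw => ?_⟩
  have h3 := h1 0
  have h4 := h2 _ ⟨w, hw, rfl⟩
  simp only [norm_zero, mul_zero, sub_zero, map_zero, zero_add] at h3
  simp only [neg_apply]
  linarith

end ConstraintQualification

/-! ### The form `q`, representatives, and stable quasidensity. -/

section StableQuasidensity

variable {E : Type*} [NormedAddCommGroup E] [NormedSpace ℝ E]

theorem hilbertNorm_sq (b : E × StrongDual ℝ E) : hilbertNorm b ^ 2 = ‖b.1‖ ^ 2 + ‖b.2‖ ^ 2 :=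
  Real.sq_sqrt (by positivity)

theorem norm_sq_le_hilbertNorm_sq (b : E × StrongDual ℝ E) : ‖b‖ ^ 2 ≤ hilbertNorm b ^ 2 := by
  rw [hilbertNorm_sq, Prod.norm_def]
  rcases max_choice ‖b.1‖ ‖b.2‖ with h | h <;> rw [h] <;>
    nlinarith [sq_nonneg ‖b.1‖, sq_nonneg ‖b.2‖]

theorem hilbertNorm_le (b : E × StrongDual ℝ E) : hilbertNorm b ≤ 2 * ‖b‖ := by
  rw [hilbertNorm, Real.sqrt_le_left (by positivity)]
  have h1 := norm_fst_le b
  have h2 := norm_snd_le b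
  nlinarith [norm_nonneg b.1, norm_nonneg b.2]

theorem abs_qForm_le (b : E × StrongDual ℝ E) : |qForm b| ≤ ‖b.2‖ * ‖b.1‖ := b.2.le_opNorm b.1

theorem rForm_nonneg (b : E × StrongDual ℝ E) : 0 ≤ rForm b := by
  have := neg_abs_le (qForm b)
  have := abs_qForm_le b
  rw [rForm, hilbertNorm_sq]
  nlinarith [sq_nonneg (‖b.1‖ - ‖b.2‖)]

theorem qForm_le_rForm (b : E × StrongDual ℝ E) : qForm b ≤ rForm b := by
  rw [rForm]; nlinarith [sq_nonneg (hilbertNorm b)]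

theorem abs_qForm_le_norm (b : E × StrongDual ℝ E) : |qForm b| ≤ ‖b‖ ^ 2 :=
  (abs_qForm_le b).trans (by
    rw [sq]; exact mul_le_mul (norm_snd_le b) (norm_fst_le b) (norm_nonneg _) (norm_nonneg _))

theorem abs_pairing_mapL_le (b c : E × StrongDual ℝ E) :
    |pairing b (mapL c)| ≤ 2 * ‖b‖ * ‖c‖ := by
  have h1 := c.2.le_opNorm b.1
  have h2 := b.2.le_opNorm c.1
  have h3 : ‖c.2‖ * ‖b.1‖ ≤ ‖c‖ * ‖b‖ :=
    mul_le_mul (norm_snd_le c) (norm_fst_le b) (norm_nonneg _) (norm_nonneg _)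
  have h4 : ‖b.2‖ * ‖c.1‖ ≤ ‖b‖ * ‖c‖ :=
    mul_le_mul (norm_snd_le b) (norm_fst_le c) (norm_nonneg _) (norm_nonneg _)
  simp only [pairing, mapL, NormedSpace.dual_def]
  rw [Real.norm_eq_abs] at h1 h2
  have := abs_add_le (c.2 b.1) (b.2 c.1)
  linarith

theorem qForm_add (b c : E × StrongDual ℝ E) :
    qForm (b + c) = qForm b + pairing b (mapL c) + qForm c := by
  simp only [qForm, pairing, mapL, NormedSpace.dual_def, Prod.fst_add, Prod.snd_add, map_add,
    add_apply]
  ring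

theorem qForm_sub (b c : E × StrongDual ℝ E) :
    qForm (b - c) = qForm b - pairing b (mapL c) + qForm c := by
  simp only [qForm, pairing, mapL, NormedSpace.dual_def, Prod.fst_sub, Prod.snd_sub, map_sub,
    sub_apply]
  ring

theorem qForm_combo (b c : E × StrongDual ℝ E) (t : ℝ) :
    qForm ((1 - t) • b + t • c) =
      (1 - t) * qForm b + t * qForm c - t * (1 - t) * qForm (b - c) := by
  simp only [qForm, Prod.fst_add, Prod.snd_add, Prod.smul_fst, Prod.smul_snd, map_add, map_smul,
    add_apply, smul_apply, smul_eq_mul, Prod.fst_sub, Prod.snd_sub, map_sub, sub_apply]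
  ring

theorem qForm_mapL (b : E × StrongDual ℝ E) : qForm (mapL b) = qForm b := by
  simp [qForm, mapL]

theorem continuous_qForm : Continuous (qForm : E × StrongDual ℝ E → ℝ) := by
  unfold qForm; fun_prop

theorem pairing_add_right (b : E × StrongDual ℝ E)
    (d e : StrongDual ℝ E × StrongDual ℝ (StrongDual ℝ E)) :
    pairing b (d + e) = pairing b d + pairing b e := by
  simp only [pairing, Prod.fst_add, Prod.snd_add, add_apply]; ring

theorem pairing_add_left (b c : E × StrongDual ℝ E)
    (d : StrongDual ℝ E × StrongDual ℝ (StrongDual ℝ E)) :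
    pairing (b + c) d = pairing b d + pairing c d := by
  simp only [pairing, Prod.fst_add, Prod.snd_add, map_add]; ring

theorem pairing_smul_left (t : ℝ) (b : E × StrongDual ℝ E)
    (d : StrongDual ℝ E × StrongDual ℝ (StrongDual ℝ E)) :
    pairing (t • b) d = t * pairing b d := by
  simp only [pairing, Prod.smul_fst, Prod.smul_snd, map_smul, smul_eq_mul]; ring

theorem continuous_pairing (d : StrongDual ℝ E × StrongDual ℝ (StrongDual ℝ E)) :
    Continuous fun b : E × StrongDual ℝ E => pairing b d := by
  unfold pairing; fun_prop

theorem pairing_mapL_comm (b c : E × StrongDual ℝ E) :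
    pairing b (mapL c) = pairing c (mapL b) := by
  simp only [pairing, mapL, NormedSpace.dual_def]; ring

theorem continuous_pairing_mapL (b : E × StrongDual ℝ E) :
    Continuous fun c : E × StrongDual ℝ E => pairing b (mapL c) := by
  simp only [pairing_mapL_comm b]; exact continuous_pairing _

/-- `C` is a convex set whose lower envelope is a function on `E × E*` which, together
with its conjugate, dominates the duality form. -/
structure IsRepresentative (C : Set ((E × StrongDual ℝ E) × ℝ)) : Prop where
  convex : Convex ℝ C
  qForm_le : ∀ p ∈ C, qForm p.1 ≤ p.2
  qForm_le_conj : ∀ d M, (∀ p ∈ C, pairing p.1 d - p.2 ≤ M) → qForm d ≤ M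

/-- The points `b` at which the conjugate of the function generated by `C` satisfies
`f* (L b) ≤ q b`. -/
def dualCoincidence (C : Set ((E × StrongDual ℝ E) × ℝ)) : Set (E × StrongDual ℝ E) :=
  {b | ∀ p ∈ C, pairing p.1 (mapL b) - p.2 ≤ qForm b}

namespace IsRepresentative

variable {C : Set ((E × StrongDual ℝ E) × ℝ)}

theorem nonempty (hC : IsRepresentative C) : C.Nonempty := by
  by_contra h
  rw [Set.not_nonempty_iff_eq_empty] at h
  have := hC.qForm_le_conj 0 (-1) (by simp [h])
  simp [qForm] at this
  linarith

theorem isClosed_dualCoincidence : IsClosed (dualCoincidence C) := by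
  simp only [dualCoincidence, Set.ofPred_forall]
  exact isClosed_iInter fun p => isClosed_iInter fun _ =>
    isClosed_le ((continuous_pairing_mapL _).sub continuous_const) continuous_qForm

/-- At the midpoint, `f* ∘ L` is at most the average of `q b` and `q c`, whereas `q` is that average
minus `q (b - c) / 4`; then `f* ≥ q` applies. -/
theorem qForm_sub_nonneg (hC : IsRepresentative C) {b c : E × StrongDual ℝ E}
    (hb : b ∈ dualCoincidence C) (hc : c ∈ dualCoincidence C) : 0 ≤ qForm (b - c) := by
  have h := hC.qForm_le_conj (mapL ((1 - 1 / 2 : ℝ) • b + (1 / 2 : ℝ) • c))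
    ((qForm b + qForm c) / 2) fun p hp => by
      have h1 := hb p hp
      have h2 := hc p hp
      rw [pairing_mapL_comm] at h1 h2 ⊢
      rw [pairing_add_left, pairing_smul_left, pairing_smul_left]
      linarith
  rw [qForm_mapL, qForm_combo] at h
  linarith

theorem gap_combo (hC : IsRepresentative C) {p p' : (E × StrongDual ℝ E) × ℝ} (hp : p ∈ C)
    (hp' : p' ∈ C) {t : ℝ} (h0 : 0 ≤ t) (h1 : t ≤ 1) :
    -(t * (1 - t) * qForm (p.1 - p'.1)) ≤
      (1 - t) * (p.2 - qForm p.1) + t * (p'.2 - qForm p'.1) := by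
  have h := hC.qForm_le _ (hC.convex hp hp' (sub_nonneg.mpr h1) h0 (by ring))
  simp only [Prod.fst_add, Prod.snd_add, Prod.smul_fst, Prod.smul_snd, smul_eq_mul] at h
  rw [qForm_combo] at h
  linarith

/-- Small gaps `f - q` prevent `q` of a difference from being very negative. As `r` is half the
squared norm plus `q`, a bound on `r` becomes a bound on the norm. -/
theorem neg_qForm_sub_le (hC : IsRepresentative C) {p p' : (E × StrongDual ℝ E) × ℝ} (hp : p ∈ C)
    (hp' : p' ∈ C) :
    -qForm (p.1 - p'.1) ≤ 2 * (p.2 - qForm p.1) + 2 * (p'.2 - qForm p'.1) := by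
  have := hC.gap_combo hp hp' (t := 1 / 2) (by norm_num) (by norm_num)
  linarith

/-- Apply `gap_combo` to `p n` and `p'`, let `n → ∞`, divide by `t` and let `t → 0`. Neither
closedness of `C` nor membership of the limit is needed. -/
theorem mem_dualCoincidence_of_tendsto (hC : IsRepresentative C)
    {p : ℕ → (E × StrongDual ℝ E) × ℝ} (hp : ∀ n, p n ∈ C) {b : E × StrongDual ℝ E}
    (hb : Filter.Tendsto (fun n => (p n).1) Filter.atTop (nhds b))
    (hgap : Filter.Tendsto (fun n => (p n).2 - qForm (p n).1) Filter.atTop (nhds 0)) :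
    b ∈ dualCoincidence C := by
  intro p' hp'
  have key : ∀ t : ℝ, 0 < t → t ≤ 1 → -((1 - t) * qForm (b - p'.1)) ≤ p'.2 - qForm p'.1 := by
    intro t h0 h1
    have hl : Filter.Tendsto (fun n => -(t * (1 - t) * qForm ((p n).1 - p'.1))) Filter.atTop
        (nhds (-(t * (1 - t) * qForm (b - p'.1)))) :=
      (((continuous_qForm.tendsto _).comp (hb.sub_const p'.1)).const_mul _).neg
    have hr := (hgap.const_mul (1 - t)).add_const (t * (p'.2 - qForm p'.1))
    have h := le_of_tendsto_of_tendsto' hl hr fun n => hC.gap_combo (hp n) hp' h0.le h1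
    refine le_of_mul_le_mul_left ?_ h0
    linarith
  have h : -((1 - (0 : ℝ)) * qForm (b - p'.1)) ≤ p'.2 - qForm p'.1 := by
    have ht : Filter.Tendsto (fun t : ℝ => -((1 - t) * qForm (b - p'.1)))
        (nhdsWithin 0 (Set.Ioi 0)) (nhds (-((1 - (0 : ℝ)) * qForm (b - p'.1)))) :=
      Continuous.continuousWithinAt (by fun_prop)
    refine le_of_tendsto ht ?_
    filter_upwards [Ioc_mem_nhdsGT (zero_lt_one (α := ℝ))] with t ht
    exact key t ht.1 ht.2
  rw [qForm_sub, pairing_mapL_comm] at h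
  linarith

/-- The quadratic parts of `-q b` and `q (b - c)` cancel, so failure would put a convex function
above the concave `ε - ‖b - c‖² / 2`. An affine function between them contradicts `f* ≥ q`. -/
theorem exists_gap_add_rForm_le (hC : IsRepresentative C) (c : E × StrongDual ℝ E) {ε : ℝ}
    (hε : 0 < ε) : ∃ p ∈ C, p.2 - qForm p.1 + rForm (p.1 - c) ≤ ε := by
  by_contra hcon
  push Not at hcon
  have hp : ConcaveOn ℝ Set.univ fun b : E × StrongDual ℝ E =>
      ε - (1 / 2 * ‖(b - c).1‖ ^ 2 + 1 / 2 * ‖(b - c).2‖ ^ 2) := by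
    have hn : ∀ {F : Type _} [NormedAddCommGroup F] [NormedSpace ℝ F] (x : F),
        ConvexOn ℝ Set.univ fun y => 1 / 2 * ‖y - x‖ ^ 2 := by
      intro F _ _ x
      have h1 : ConvexOn ℝ Set.univ fun y : F => ‖y - x‖ := by
        simp only [sub_eq_add_neg]
        exact (convexOn_univ_norm (E := F)).translate_left (-x)
      exact (h1.pow (fun _ _ => norm_nonneg _) 2).smul (by norm_num)
    have h1 := (hn c.1).comp_linearMap (LinearMap.fst ℝ E (StrongDual ℝ E))
    have h2 := (hn c.2).comp_linearMap (LinearMap.snd ℝ E (StrongDual ℝ E))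
    exact (concaveOn_const ε convex_univ).sub (h1.add h2)
  have hC' : Convex ℝ
      ((fun z : (E × StrongDual ℝ E) × ℝ => (z.1, z.2 - pairing z.1 (mapL c) + qForm c)) '' C) := by
    rintro _ ⟨z, hz, rfl⟩ _ ⟨w, hw, rfl⟩ s t hs ht hst
    refine ⟨s • z + t • w, hC.convex hz hw hs ht hst, ?_⟩
    refine Prod.ext rfl ?_
    simp only [Prod.fst_add, Prod.snd_add, Prod.smul_fst, Prod.smul_snd, pairing_add_left,
      pairing_smul_left, smul_eq_mul]
    have : t = 1 - s := by linarith
    subst this; ring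
  obtain ⟨d, α, h1, h2⟩ := exists_affine_between hC' (hC.nonempty.image _) hp (by fun_prop) (by
    rintro _ ⟨z, hz, rfl⟩
    have := hcon z hz
    rw [rForm, hilbertNorm_sq, qForm_sub] at this
    linarith)
  set e : StrongDual ℝ E × StrongDual ℝ (StrongDual ℝ E) :=
    (d.comp (ContinuousLinearMap.inl ℝ _ _), d.comp (ContinuousLinearMap.inr ℝ _ _)) with he
  have hde : ∀ b, d b = pairing b e := by
    intro b
    simp only [pairing, he, ContinuousLinearMap.comp_apply, ContinuousLinearMap.inl_apply,
      ContinuousLinearMap.inr_apply]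
    rw [← map_add]
    simp
  have h3 := hC.qForm_le_conj (mapL c + e) (qForm c - α) fun p hp => by
    have := h2 _ ⟨p, hp, rfl⟩
    rw [hde] at this
    rw [pairing_add_right]
    linarith
  -- At `c + (-x, e.1)` the second component contributes exactly `e.2 e.1 = q e`, so only `e.1`
  -- needs an almost aligned vector.
  obtain ⟨x, hx⟩ := exists_almost_aligned e.1 (half_pos hε)
  have h4 := h1 (c + (-x, e.1))
  rw [hde, pairing_add_left] at h4
  have h5 : qForm (mapL c + e) = qForm c + pairing c e + qForm e := by
    simp only [qForm, mapL, pairing, Prod.fst_add, Prod.snd_add, map_add, add_apply,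
      NormedSpace.dual_def]
    ring
  have h6 : pairing (-x, e.1) e = -e.1 x + qForm e := by simp [pairing, qForm]
  simp only [add_sub_cancel_left, norm_neg] at h4
  rw [h5] at h3
  rw [h6] at h4
  linarith

theorem exists_mem_dualCoincidence_near [CompleteSpace E] (hC : IsRepresentative C)
    {p : (E × StrongDual ℝ E) × ℝ} (hp : p ∈ C) {η : ℝ} (hη : 0 < η)
    (hgap : p.2 - qForm p.1 ≤ η ^ 2) :
    ∃ b ∈ dualCoincidence C, ‖b - p.1‖ ≤ 6 * η := by
  have step : ∀ (n : ℕ) (p : C), ∃ p' : C,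
      p'.1.2 - qForm p'.1.1 + rForm (p'.1.1 - p.1.1) ≤ (η / 2 ^ (n + 1)) ^ 2 := fun n p => by
    obtain ⟨p', hp', h⟩ := hC.exists_gap_add_rForm_le p.1.1
      (show 0 < (η / 2 ^ (n + 1)) ^ 2 by positivity)
    exact ⟨⟨p', hp'⟩, h⟩
  choose g hg using step
  let P : ℕ → C := fun n => Nat.rec ⟨p, hp⟩ (fun n p => g n p) n
  have hP : ∀ n, (P (n + 1)).1.2 - qForm (P (n + 1)).1.1 +
      rForm ((P (n + 1)).1.1 - (P n).1.1) ≤ (η / 2 ^ (n + 1)) ^ 2 := fun n => hg n (P n)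
  have hgapP : ∀ n, (P n).1.2 - qForm (P n).1.1 ≤ (η / 2 ^ n) ^ 2 := by
    intro n
    cases n with
    | zero => simpa [P] using hgap
    | succ n => linarith [hP n, rForm_nonneg ((P (n + 1)).1.1 - (P n).1.1)]
  have hgap0 : ∀ n, 0 ≤ (P n).1.2 - qForm (P n).1.1 := fun n =>
    sub_nonneg.mpr (hC.qForm_le _ (P n).2)
  -- With `τ = (η / 2 ^ n) ^ 2`, the estimates give a squared step of at most `5 τ`; it is relaxed
  -- to `9 τ`, so the steps `3 η / 2 ^ n` sum to `6 η`.
  have hdist : ∀ n, dist (P n).1.1 (P (n + 1)).1.1 ≤ 6 * η / 2 / 2 ^ n := by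
    intro n
    rw [dist_comm, dist_eq_norm]
    have h1 := hP n
    have h2 := hC.neg_qForm_sub_le (P (n + 1)).2 (P n).2
    have h3 := norm_sq_le_hilbertNorm_sq ((P (n + 1)).1.1 - (P n).1.1)
    have h4 := hgapP n
    have h5 := hgapP (n + 1)
    have h6 := hgap0 (n + 1)
    rw [rForm] at h1
    have e : (η / 2 ^ (n + 1)) ^ 2 = (η / 2 ^ n) ^ 2 / 4 := by
      rw [pow_succ]; field_simp; ring
    rw [e] at h1 h5
    have h7 : ‖(P (n + 1)).1.1 - (P n).1.1‖ ^ 2 ≤ (6 * η / 2 / 2 ^ n) ^ 2 := by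
      have : (6 * η / 2 / 2 ^ n) ^ 2 = 9 * (η / 2 ^ n) ^ 2 := by field_simp; norm_num
      rw [this]
      have := sq_nonneg (η / 2 ^ n)
      linarith
    exact (sq_le_sq₀ (norm_nonneg _) (by positivity)).mp h7
  obtain ⟨b, hb⟩ := cauchySeq_tendsto_of_complete (cauchySeq_of_le_geometric_two hdist)
  refine ⟨b, hC.mem_dualCoincidence_of_tendsto (fun n => (P n).2) hb ?_, ?_⟩
  · refine squeeze_zero hgap0 hgapP ?_
    have h : Filter.Tendsto (fun n : ℕ => η * (1 / 2 : ℝ) ^ n) Filter.atTop (nhds (η * 0)) :=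
      (tendsto_pow_atTop_nhds_zero_of_lt_one (by norm_num) (by norm_num)).const_mul η
    have h' := h.pow 2
    simp only [mul_zero, ne_eq, OfNat.ofNat_ne_zero, not_false_eq_true, zero_pow] at h'
    refine h'.congr fun n => ?_
    rw [one_div, inv_pow, div_eq_mul_inv]
  · have := dist_le_of_le_geometric_two_of_tendsto₀ hdist hb
    rwa [dist_comm, dist_eq_norm] at this

theorem isStablyQuasidenseSet_dualCoincidence [CompleteSpace E] (hC : IsRepresentative C) :
    IsStablyQuasidenseSet (dualCoincidence C) := by
  intro c
  -- Comparison with one fixed `a ∈ C` bounds all near-minimizers independently of `ε`, which yields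
  -- stability.
  obtain ⟨a, ha⟩ := hC.nonempty
  have hga := sub_nonneg.mpr (hC.qForm_le a ha)
  set D := ‖a.1 - c‖ with hD
  have hD0 : 0 ≤ D := norm_nonneg _
  set G := a.2 - qForm a.1 with hG
  set K := 4 * D + (6 + 4 * G + 6 * D ^ 2) with hK
  have hK1 : 1 ≤ K := by nlinarith
  refine ⟨2 * (K + 6), by positivity, ?_⟩
  refine EReal.le_of_forall_lt_iff_le.mp fun ε hε => ?_
  have hε : 0 < ε := by exact_mod_cast hε
  -- Moving from `p` to `b` raises `r` by at most `24 K η + 72 η ^ 2`, and `r (p.1 - c) ≤ η ^ 2`.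
  set η := min 1 (ε / (73 + 24 * K)) with hη
  have hη0 : 0 < η := by positivity
  have hη1 : η ≤ 1 := min_le_left _ _
  have hηε : η * (73 + 24 * K) ≤ ε := by
    rw [← le_div_iff₀ (by positivity)]; exact min_le_right _ _
  obtain ⟨p, hp, hpr⟩ := hC.exists_gap_add_rForm_le c (show 0 < η ^ 2 by positivity)
  have hp0 := sub_nonneg.mpr (hC.qForm_le p hp)
  have hr0 := rForm_nonneg (p.1 - c)
  have hη2 : η ^ 2 ≤ η := by nlinarith
  have hN : ‖p.1 - c‖ ≤ K := by
    set N := ‖p.1 - c‖ with hN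
    have h1 := hC.neg_qForm_sub_le hp ha
    have h2 : qForm (p.1 - c) = qForm (p.1 - a.1) + pairing (p.1 - a.1) (mapL (a.1 - c))
        + qForm (a.1 - c) := by rw [← qForm_add, sub_add_sub_cancel]
    have h3 := abs_pairing_mapL_le (p.1 - a.1) (a.1 - c)
    have h4 := abs_qForm_le_norm (a.1 - c)
    have h5 : ‖p.1 - a.1‖ ≤ N + D := by
      have := norm_sub_le (p.1 - c) (a.1 - c)
      rwa [sub_sub_sub_cancel_right] at this
    have h6 := norm_sq_le_hilbertNorm_sq (p.1 - c)
    rw [rForm] at hpr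
    have h7 := neg_abs_le (qForm (a.1 - c))
    have h8 := neg_abs_le (pairing (p.1 - a.1) (mapL (a.1 - c)))
    rw [rForm] at hr0
    have h9 : 2 * ‖p.1 - a.1‖ * D ≤ 2 * (N + D) * D := by nlinarith
    have h10 : N ^ 2 ≤ 4 * D * N + (6 + 4 * G + 6 * D ^ 2) := by
      rw [← hD] at h3 h4
      rw [← hN] at h6
      linarith
    by_contra hcon
    push Not at hcon
    have h11 : 1 ≤ N := by linarith
    nlinarith [mul_le_mul_of_nonneg_left h11 (show 0 ≤ 6 + 4 * G + 6 * D ^ 2 by positivity)]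
  obtain ⟨b, hb, hbp⟩ := hC.exists_mem_dualCoincidence_near hp hη0 (by linarith)
  have hsplit : b - c = (b - p.1) + (p.1 - c) := (sub_add_sub_cancel _ _ _).symm
  refine iInf₂_le_of_le b ⟨hb, ?_⟩ ?_
  · refine (hilbertNorm_le _).trans ?_
    have := norm_add_le (b - p.1) (p.1 - c)
    rw [← hsplit] at this
    linarith
  · rw [EReal.coe_le_coe_iff]
    have h1 := (abs_le.mp (abs_qForm_le_norm (b - p.1))).2
    have h2 := (abs_le.mp (abs_pairing_mapL_le (b - p.1) (p.1 - c))).2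
    have h3 : qForm (b - c) = qForm (b - p.1) + pairing (b - p.1) (mapL (p.1 - c))
        + qForm (p.1 - c) := by rw [← qForm_add, ← hsplit]
    have hsq : ∀ x y : ℝ, 0 ≤ y → x ≤ y + 6 * η → 0 ≤ x → y ≤ K →
        x ^ 2 ≤ y ^ 2 + 12 * η * K + 36 * η ^ 2 := by
      intro x y hy hx hx0 hyK
      nlinarith
    have h4 := hsq ‖(b - c).1‖ ‖(p.1 - c).1‖ (norm_nonneg _) (by
      rw [hsplit, Prod.fst_add]
      have := norm_add_le (b - p.1).1 (p.1 - c).1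
      have := norm_fst_le (b - p.1)
      linarith) (norm_nonneg _) ((norm_fst_le _).trans hN)
    have h5 := hsq ‖(b - c).2‖ ‖(p.1 - c).2‖ (norm_nonneg _) (by
      rw [hsplit, Prod.snd_add]
      have := norm_add_le (b - p.1).2 (p.1 - c).2
      have := norm_snd_le (b - p.1)
      linarith) (norm_nonneg _) ((norm_snd_le _).trans hN)
    have h6 : ‖b - p.1‖ ^ 2 ≤ 36 * η ^ 2 := by
      have := norm_nonneg (b - p.1)
      nlinarith
    have h7 : 2 * ‖b - p.1‖ * ‖p.1 - c‖ ≤ 12 * η * K := by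
      have := mul_le_mul hbp hN (norm_nonneg _) (by positivity)
      linarith
    rw [rForm, hilbertNorm_sq] at hpr ⊢
    linarith

end IsRepresentative

end StableQuasidensity

/-! ### Fitzpatrick functions of monotone quasidense sets. -/

section FitzpatrickExtension

variable {E : Type*} [NormedAddCommGroup E] [NormedSpace ℝ E]

/-- The epigraph of the Fitzpatrick function of `A`. -/
def fitzEpi (A : Set (E × StrongDual ℝ E)) : Set ((E × StrongDual ℝ E) × ℝ) :=
  {p | ∀ a ∈ A, pairing a (mapL p.1) - qForm a ≤ p.2}

variable {A : Set (E × StrongDual ℝ E)}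

theorem fitz_le_coe_iff {b : E × StrongDual ℝ E} {s : ℝ} :
    fitz A b ≤ (s : EReal) ↔ (b, s) ∈ fitzEpi A := by
  simp only [fitz, iSup_le_iff, EReal.coe_le_coe_iff, fitzEpi, Set.mem_ofPred_eq]

theorem fitz_ne_bot (hA : A.Nonempty) (b : E × StrongDual ℝ E) : fitz A b ≠ ⊥ := by
  obtain ⟨a, ha⟩ := hA
  have h : ((pairing a (mapL b) - qForm a : ℝ) : EReal) ≤ fitz A b :=
    le_iSup₂ (f := fun a (_ : a ∈ A) => ((pairing a (mapL b) - qForm a : ℝ) : EReal)) a ha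
  intro hbot
  rw [hbot, le_bot_iff] at h
  exact EReal.coe_ne_bot _ h

theorem mem_effDom_fitz_iff (hA : A.Nonempty) {b : E × StrongDual ℝ E} :
    b ∈ effDom (fitz A) ↔ ∃ s, (b, s) ∈ fitzEpi A := by
  constructor
  · rintro ⟨r, hr⟩
    exact ⟨r, fitz_le_coe_iff.mp hr.le⟩
  · rintro ⟨s, hs⟩
    rw [← fitz_le_coe_iff] at hs
    have htop : fitz A b ≠ ⊤ := fun h => EReal.coe_ne_top s (top_le_iff.mp (h ▸ hs))
    exact ⟨(fitz A b).toReal, (EReal.coe_toReal htop (fitz_ne_bot hA b)).symm⟩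

theorem conj_fitz_le_coe_iff (hA : A.Nonempty)
    {d : StrongDual ℝ E × StrongDual ℝ (StrongDual ℝ E)} {M : ℝ} :
    conj (fitz A) d ≤ (M : EReal) ↔ ∀ p ∈ fitzEpi A, pairing p.1 d - p.2 ≤ M := by
  rw [conj, iSup_le_iff]
  constructor
  · rintro h ⟨b, s⟩ hp
    rw [← fitz_le_coe_iff] at hp
    have := (EReal.sub_le_sub le_rfl hp).trans (h b)
    exact_mod_cast this
  · intro h b
    by_cases htop : fitz A b = ⊤
    · rw [htop, EReal.sub_top]; exact bot_le
    · have e := EReal.coe_toReal htop (fitz_ne_bot hA b)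
      have := h (b, (fitz A b).toReal) (fitz_le_coe_iff.mp e.symm.le)
      rw [← e]
      exact_mod_cast this

theorem convex_fitzEpi : Convex ℝ (fitzEpi A) := by
  intro p hp p' hp' s t hs ht hst a ha
  have h1 := mul_le_mul_of_nonneg_left (hp a ha) hs
  have h2 := mul_le_mul_of_nonneg_left (hp' a ha) ht
  rw [pairing_mapL_comm] at h1 h2 ⊢
  simp only [Prod.fst_add, Prod.snd_add, Prod.smul_fst, Prod.smul_snd, pairing_add_left,
    pairing_smul_left, smul_eq_mul]
  have : qForm a = s * qForm a + t * qForm a := by rw [← add_mul, hst, one_mul]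
  linarith

theorem isClosed_fitzEpi : IsClosed (fitzEpi A) := by
  simp only [fitzEpi, Set.ofPred_forall]
  exact isClosed_iInter fun a => isClosed_iInter fun _ =>
    isClosed_le (((continuous_pairing_mapL a).comp continuous_fst).sub continuous_const)
      continuous_snd

theorem mem_fitzEpi_of_mem (hm : ∀ a ∈ A, ∀ b ∈ A, 0 ≤ qForm (a - b)) {a : E × StrongDual ℝ E}
    (ha : a ∈ A) : (a, qForm a) ∈ fitzEpi A := by
  intro b hb
  have := hm b hb a ha
  rw [qForm_sub] at this
  linarith

theorem QuasidenseSum.IsQuasidenseSet.exists_rForm_lt (hq : IsQuasidenseSet A)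
    (c : E × StrongDual ℝ E) {ε : ℝ} (hε : 0 < ε) : ∃ a ∈ A, rForm (a - c) < ε := by
  have h : (⨅ a ∈ A, (rForm (a - c) : EReal)) < (ε : EReal) :=
    lt_of_le_of_lt (hq c) (by exact_mod_cast hε)
  obtain ⟨a, ha⟩ := iInf_lt_iff.mp h
  obtain ⟨haA, ha⟩ := iInf_lt_iff.mp ha
  exact ⟨a, haA, by exact_mod_cast ha⟩

theorem QuasidenseSum.IsQuasidenseSet.nonempty (hq : IsQuasidenseSet A) : A.Nonempty :=
  let ⟨a, ha, _⟩ := hq.exists_rForm_lt 0 one_pos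
  ⟨a, ha⟩

/-- A quasidense set is of type (NI). -/
theorem QuasidenseSum.IsQuasidenseSet.exists_qForm_mapL_sub_le (hq : IsQuasidenseSet A)
    (d : StrongDual ℝ E × StrongDual ℝ (StrongDual ℝ E)) {ε : ℝ} (hε : 0 < ε) :
    ∃ a ∈ A, qForm (mapL a - d) ≤ ε := by
  obtain ⟨w, hw⟩ := exists_almost_aligned d.2 (half_pos hε)
  -- The shift `w` is almost aligned with `d.2`, so `-d.2 w` offsets the half-squares of `‖w‖` and
  -- `‖d.2‖` produced by Young's inequality on the cross terms.
  obtain ⟨a, ha, har⟩ := hq.exists_rForm_lt ((0, d.1 + w) : E × StrongDual ℝ E) (half_pos hε)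
  refine ⟨a, ha, ?_⟩
  have e : qForm (mapL a - d) = qForm (a - (0, d.1 + w)) + w a.1 - d.2 (a - (0, d.1 + w)).2
      - d.2 w := by
    simp only [qForm, mapL, Prod.fst_sub, Prod.snd_sub, sub_apply, NormedSpace.dual_def, map_sub,
      map_add, add_apply, sub_zero]
    ring
  set b := a - (0, d.1 + w) with hb
  have ha1 : a.1 = b.1 := by simp [hb]
  have h1 := (abs_le.mp (w.le_opNorm b.1)).2
  have h2 := (abs_le.mp (d.2.le_opNorm b.2)).1
  rw [e, ha1]
  rw [rForm, hilbertNorm_sq] at har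
  nlinarith [sq_nonneg (‖w‖ - ‖b.1‖), sq_nonneg (‖d.2‖ - ‖b.2‖)]

/-- Completing the square gives `φ_A b = q b - inf q (a - b)`, with `q ≤ r`. By monotonicity `φ_A a
≤ q a` on `A`, so `φ_A* d ≥ q d - q (L a - d)`, and type (NI) applies. -/
theorem isRepresentative_fitzEpi (hm : ∀ a ∈ A, ∀ b ∈ A, 0 ≤ qForm (a - b))
    (hq : IsQuasidenseSet A) : IsRepresentative (fitzEpi A) where
  convex := convex_fitzEpi
  qForm_le p hp := by
    refine le_of_forall_pos_le_add fun ε hε => ?_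
    obtain ⟨a, ha, har⟩ := hq.exists_rForm_lt p.1 hε
    have h1 := hp a ha
    have h2 := qForm_le_rForm (a - p.1)
    rw [qForm_sub] at h2
    linarith
  qForm_le_conj d M h := by
    refine le_of_forall_pos_le_add fun ε hε => ?_
    obtain ⟨a, ha, had⟩ := hq.exists_qForm_mapL_sub_le d hε
    have h1 := h _ (mem_fitzEpi_of_mem hm ha)
    have e : qForm (mapL a - d) = qForm a - pairing a d + qForm d := by
      simp only [qForm, mapL, pairing, Prod.fst_sub, Prod.snd_sub, sub_apply,
        NormedSpace.dual_def, map_sub]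
      ring
    linarith

theorem mem_fitzExt_iff (hm : ∀ a ∈ A, ∀ b ∈ A, 0 ≤ qForm (a - b)) (hq : IsQuasidenseSet A)
    {d : StrongDual ℝ E × StrongDual ℝ (StrongDual ℝ E)} :
    d ∈ fitzExt A ↔ ∀ p ∈ fitzEpi A, pairing p.1 d - p.2 ≤ qForm d := by
  rw [← conj_fitz_le_coe_iff hq.nonempty]
  refine ⟨fun h => le_of_eq h, fun h => le_antisymm h ?_⟩
  refine EReal.le_of_forall_lt_iff_le.mp fun M hM => ?_
  exact_mod_cast (isRepresentative_fitzEpi hm hq).qForm_le_conj d M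
    ((conj_fitz_le_coe_iff hq.nonempty).mp hM.le)

/-- This is maximal monotonicity: if `q (a - b) ≥ 0` for all `a ∈ A`, then small `r (a - b)` forces
small `‖a - b‖`, so `b` lies in the closure of `A`. -/
theorem mapL_mem_fitzExt_iff (hc : IsClosed A) (hm : ∀ a ∈ A, ∀ b ∈ A, 0 ≤ qForm (a - b))
    (hq : IsQuasidenseSet A) {b : E × StrongDual ℝ E} : mapL b ∈ fitzExt A ↔ b ∈ A := by
  rw [mem_fitzExt_iff hm hq, qForm_mapL]
  constructor
  · intro h
    have hpos : ∀ a ∈ A, 0 ≤ qForm (a - b) := fun a ha => by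
      have := h _ (mem_fitzEpi_of_mem hm ha)
      rw [qForm_sub]
      linarith
    rw [← hc.closure_eq, Metric.mem_closure_iff]
    intro ε hε
    obtain ⟨a, ha, har⟩ := hq.exists_rForm_lt b (show 0 < ε ^ 2 / 2 by positivity)
    refine ⟨a, ha, ?_⟩
    rw [dist_comm, dist_eq_norm]
    have h1 := norm_sq_le_hilbertNorm_sq (a - b)
    have h2 := hpos a ha
    rw [rForm] at har
    exact (sq_lt_sq₀ (norm_nonneg _) hε.le).mp (by linarith)
  · intro hb p hp
    have := hp b hb
    rw [pairing_mapL_comm]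
    linarith

end FitzpatrickExtension

/-! ### Partial inf-convolution and the parallel sum. -/

section ParallelSum

variable {E : Type*} [NormedAddCommGroup E] [NormedSpace ℝ E]

/-- Partial inf-convolution in the first variable, in terms of epigraphs. -/
def partialEpiSum (F G : Set ((E × StrongDual ℝ E) × ℝ)) : Set ((E × StrongDual ℝ E) × ℝ) :=
  {p | ∃ z ∈ F, ∃ w ∈ G, z.1.2 = p.1.2 ∧ w.1.2 = p.1.2 ∧ p.1.1 = z.1.1 + w.1.1 ∧ p.2 = z.2 + w.2}

variable {F G : Set ((E × StrongDual ℝ E) × ℝ)}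

/-- The inf-convolution is a minimization over `F ×ˢ G` constrained by equal second components; the
Lagrange multiplier of this constraint is the splitting of `d.2`. -/
theorem exists_conj_partialEpiSum_split [CompleteSpace E] (hF : Convex ℝ F) (hFc : IsClosed F)
    (hG : Convex ℝ G) (hGc : IsClosed G)
    (hcone : IsClosedSubspace (diffCone ((fun p => p.1.2) '' F) ((fun p => p.1.2) '' G)))
    (d : StrongDual ℝ E × StrongDual ℝ (StrongDual ℝ E)) {M : ℝ}
    (hM : ∀ p ∈ partialEpiSum F G, pairing p.1 d - p.2 ≤ M) :
    ∃ v : StrongDual ℝ (StrongDual ℝ E), ∀ p ∈ F, ∀ p' ∈ G,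
      (pairing p.1 (d.1, v) - p.2) + (pairing p'.1 (d.1, d.2 - v) - p'.2) ≤ M := by
  obtain ⟨hclosed, Z, hZ⟩ := hcone
  rw [← hZ] at hclosed
  have hmem : ∀ z, z ∈ Z ↔ ∃ t : ℝ, 0 < t ∧ ∃ p ∈ F, ∃ p' ∈ G, z = t • (p.1.2 - p'.1.2) := by
    intro z
    rw [← SetLike.mem_coe, hZ, diffCone]
    simp only [Set.mem_iUnion, exists_prop]
    refine exists_congr fun t => and_congr_right fun _ => ?_
    constructor
    · rintro ⟨_, ⟨_, ⟨p, hp, rfl⟩, _, ⟨p', hp', rfl⟩, rfl⟩, rfl⟩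
      exact ⟨p, hp, p', hp', rfl⟩
    · rintro ⟨p, hp, p', hp', rfl⟩
      exact ⟨_, ⟨_, ⟨p, hp, rfl⟩, _, ⟨p', hp', rfl⟩, rfl⟩, rfl⟩
  let ι := (E × StrongDual ℝ E) × ℝ
  let π₁ : ι × ι →L[ℝ] ι := ContinuousLinearMap.fst ℝ ι ι
  let π₂ : ι × ι →L[ℝ] ι := ContinuousLinearMap.snd ℝ ι ι
  let ρ : ι →L[ℝ] ℝ := ContinuousLinearMap.snd ℝ (E × StrongDual ℝ E) ℝ
  let σ : ι →L[ℝ] E × StrongDual ℝ E := ContinuousLinearMap.fst ℝ (E × StrongDual ℝ E) ℝ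
  let ξ : ι →L[ℝ] E := (ContinuousLinearMap.fst ℝ E (StrongDual ℝ E)).comp σ
  let η : ι →L[ℝ] StrongDual ℝ E := (ContinuousLinearMap.snd ℝ E (StrongDual ℝ E)).comp σ
  let φ : StrongDual ℝ (ι × ι) :=
    (ρ - d.1.comp ξ).comp π₁ + (ρ - d.1.comp ξ - d.2.comp η).comp π₂
  have hφ : ∀ p p' : ι, φ (p, p') = p.2 - d.1 p.1.1 + (p'.2 - d.1 p'.1.1 - d.2 p'.1.2) :=
    fun p p' => rfl
  obtain ⟨v, hv⟩ := exists_lagrange_multiplier (W := F ×ˢ G) (hF.prod hG) (hFc.prod hGc)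
    (η.comp π₁ - η.comp π₂) hclosed.isComplete
    (by
      rintro ⟨p, p'⟩ ⟨hp, hp'⟩
      exact (hmem _).mpr ⟨1, one_pos, p, hp, p', hp', (one_smul _ _).symm⟩)
    (by
      intro z hz
      obtain ⟨t, ht, p, hp, p', hp', rfl⟩ := (hmem z).mp hz
      exact ⟨t, ht, (p, p'), ⟨hp, hp'⟩, rfl⟩)
    φ (m := -M) (by
      rintro ⟨p, p'⟩ ⟨hp, hp'⟩ h0
      have h0 : p.1.2 = p'.1.2 := sub_eq_zero.mp h0
      have h := hM ((p.1.1 + p'.1.1, p'.1.2), p.2 + p'.2) ⟨p, hp, p', hp', h0, rfl, rfl, rfl⟩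
      simp only [pairing, map_add] at h
      rw [hφ]
      linarith)
  refine ⟨-v, fun p hp p' hp' => ?_⟩
  have h : -M ≤ φ (p, p') + v (p.1.2 - p'.1.2) := hv (p, p') ⟨hp, hp'⟩
  rw [hφ, map_sub] at h
  simp only [pairing, neg_apply, sub_apply]
  linarith

theorem isRepresentative_partialEpiSum [CompleteSpace E] (hF : IsRepresentative F)
    (hFc : IsClosed F) (hG : IsRepresentative G) (hGc : IsClosed G)
    (hcone : IsClosedSubspace (diffCone ((fun p => p.1.2) '' F) ((fun p => p.1.2) '' G))) :
    IsRepresentative (partialEpiSum F G) where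
  convex := by
    rintro p ⟨z, hz, w, hw, h1, h2, h3, h4⟩ p' ⟨z', hz', w', hw', h1', h2', h3', h4'⟩ s t hs ht hst
    refine ⟨_, hF.convex hz hz' hs ht hst, _, hG.convex hw hw' hs ht hst, ?_, ?_, ?_, ?_⟩
    · simp [h1, h1']
    · simp [h2, h2']
    · simp only [Prod.fst_add, Prod.smul_fst, h3, h3', smul_add]; abel
    · simp only [Prod.snd_add, Prod.smul_snd, h4, h4', smul_add]; abel
  qForm_le := by
    rintro p ⟨z, hz, w, hw, h1, h2, h3, h4⟩
    have h5 := hF.qForm_le z hz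
    have h6 := hG.qForm_le w hw
    rw [qForm, h1] at h5
    rw [qForm, h2] at h6
    rw [qForm, h3, h4, map_add]
    linarith
  qForm_le_conj d M hM := by
    obtain ⟨v, hv⟩ := exists_conj_partialEpiSum_split hF.convex hFc hG.convex hGc hcone d hM
    -- The joint supremum is separated by freezing `p'`, applying the bound for `F`, and then
    -- applying the bound for `G`.
    have h1 : ∀ p' ∈ G, qForm (d.1, v) ≤ M - (pairing p'.1 (d.1, d.2 - v) - p'.2) :=
      fun p' hp' => hF.qForm_le_conj _ _ fun p hp => by linarith [hv p hp p' hp']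
    have h2 := hG.qForm_le_conj (d.1, d.2 - v) (M - qForm (d.1, v)) fun p' hp' => by
      linarith [h1 p' hp']
    simp only [qForm, sub_apply] at h2 ⊢
    linarith

variable {S T : Multi E (StrongDual ℝ E)}

theorem graph_extendedParallelSum [CompleteSpace E] (hSm : S.IsMonotone) (hSq : S.Quasidense)
    (hTm : T.IsMonotone) (hTq : T.Quasidense)
    (hcone : IsClosedSubspace (diffCone ((fun p => p.1.2) '' fitzEpi S.graph)
      ((fun p => p.1.2) '' fitzEpi T.graph))) :
    (S.extendedParallelSum T).graph =
      dualCoincidence (partialEpiSum (fitzEpi S.graph) (fitzEpi T.graph)) := by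
  have hS := isRepresentative_fitzEpi hSm hSq
  have hT := isRepresentative_fitzEpi hTm hTq
  ext ⟨y, y'⟩
  constructor
  · rintro ⟨v, hv, v', hv', hvv⟩
    have hv : (y', v) ∈ fitzExt S.graph := hv
    have hv' : (y', v') ∈ fitzExt T.graph := hv'
    have hvv : v + v' = NormedSpace.inclusionInDoubleDual ℝ E y := hvv
    rw [mem_fitzExt_iff hSm hSq] at hv
    rw [mem_fitzExt_iff hTm hTq] at hv'
    rintro p ⟨z, hz, w, hw, h1, h2, h3, h4⟩
    have h5 := hv z hz
    have h6 := hv' w hw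
    have h7 : v y' + v' y' = y' y := by rw [← add_apply, hvv, NormedSpace.dual_def]
    have h8 : v p.1.2 + v' p.1.2 = p.1.2 y := by rw [← add_apply, hvv, NormedSpace.dual_def]
    simp only [pairing, qForm, h1, h2] at h5 h6
    simp only [pairing, mapL, qForm, NormedSpace.dual_def, h3, h4, map_add]
    linarith
  · intro h
    obtain ⟨v, hv⟩ := exists_conj_partialEpiSum_split hS.convex isClosed_fitzEpi hT.convex
      isClosed_fitzEpi hcone _ h
    set v' : StrongDual ℝ (StrongDual ℝ E) := NormedSpace.inclusionInDoubleDual ℝ E y - v with hv'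
    have hsum : qForm (y', v) + qForm (y', v') = qForm (y, y') := by
      simp only [qForm, hv', sub_apply, NormedSpace.dual_def]; ring
    replace hv : ∀ p ∈ fitzEpi S.graph, ∀ p' ∈ fitzEpi T.graph,
        (pairing p.1 (y', v) - p.2) + (pairing p'.1 (y', v') - p'.2) ≤ qForm (y, y') := hv
    refine ⟨v, ?_, v', ?_, add_sub_cancel v _⟩
    · refine (mem_fitzExt_iff hSm hSq).mpr fun p hp => ?_
      have := hT.qForm_le_conj (y', v') (qForm (y, y') - (pairing p.1 (y', v) - p.2))
        fun p' hp' => by linarith [hv p hp p' hp']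
      linarith
    · refine (mem_fitzExt_iff hTm hTq).mpr fun p' hp' => ?_
      have := hS.qForm_le_conj (y', v) (qForm (y, y') - (pairing p'.1 (y', v') - p'.2))
        fun p hp => by linarith [hv p hp p' hp']
      linarith

/-- If the summand from `T^𝔽` is canonical, so is its difference from `ŷ`, and at canonical points
`S^𝔽` reduces to `S`. -/
theorem extendedParallelSum_eq_parallelSum (hSc : S.Closed) (hSm : S.IsMonotone)
    (hSq : S.Quasidense) (hT : fitzExt T.graph = mapL '' T.graph) :
    S.extendedParallelSum T = S.parallelSum T := by
  funext y
  ext y'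
  constructor
  · rintro ⟨v, hv, v', hv', hvv⟩
    have hv : (y', v) ∈ fitzExt S.graph := hv
    have hv' : (y', v') ∈ fitzExt T.graph := hv'
    rw [hT] at hv'
    obtain ⟨⟨u, u'⟩, hu, hue⟩ := hv'
    simp only [mapL, Prod.mk.injEq] at hue
    obtain ⟨rfl, rfl⟩ := hue
    have hvv : v = NormedSpace.inclusionInDoubleDual ℝ E (y - u) := by
      rw [map_sub]; exact eq_sub_of_add_eq hvv
    subst hvv
    exact ⟨y - u, (mapL_mem_fitzExt_iff (b := (y - u, u')) hSc hSm hSq).mp hv, u, hu,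
      sub_add_cancel y u⟩
  · rintro ⟨x, hx, u, hu, rfl⟩
    refine ⟨NormedSpace.inclusionInDoubleDual ℝ E x,
      (mapL_mem_fitzExt_iff (b := (x, y')) hSc hSm hSq).mpr hx,
      NormedSpace.inclusionInDoubleDual ℝ E u, ?_, (map_add _ _ _).symm⟩
    change (y', _) ∈ fitzExt T.graph
    rw [hT]
    exact ⟨(u, y'), hu, rfl⟩

end ParallelSum

/-! ### Ranges, cones of differences, and the theorem. -/

theorem diffCone_eq_univ_of_interior {X : Type*} [NormedAddCommGroup X] [NormedSpace ℝ X]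
    {A B : Set X} (h : (A ∩ interior B).Nonempty ∨ (interior A ∩ B).Nonempty) :
    diffCone A B = Set.univ := by
  have hnhds : A - B ∈ nhds (0 : X) := by
    rcases h with ⟨x, hA, hB⟩ | ⟨x, hA, hB⟩
    · have : Filter.Tendsto (fun z => x - z) (nhds (0 : X)) (nhds x) := by
        simpa using (tendsto_const_nhds (x := x)).sub (Filter.tendsto_id (x := nhds (0 : X)))
      filter_upwards [this (mem_interior_iff_mem_nhds.mp hB)] with z hz
      exact ⟨x, hA, x - z, hz, sub_sub_cancel x z⟩
    · have : Filter.Tendsto (fun z => z + x) (nhds (0 : X)) (nhds x) := by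
        simpa using (Filter.tendsto_id (x := nhds (0 : X))).add_const x
      filter_upwards [this (mem_interior_iff_mem_nhds.mp hA)] with z hz
      exact ⟨z + x, hz, x, hB, add_sub_cancel_right z x⟩
  refine Set.eq_univ_of_forall fun z => ?_
  have ht : Filter.Tendsto (fun s : ℝ => s • z) (nhdsWithin 0 (Set.Ioi 0)) (nhds 0) := by
    have : Filter.Tendsto (fun s : ℝ => s • z) (nhds 0) (nhds ((0 : ℝ) • z)) :=
      Continuous.tendsto (by fun_prop) 0
    rw [zero_smul] at this
    exact this.mono_left nhdsWithin_le_nhds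
  obtain ⟨s, hs, hs0⟩ := ((ht.eventually hnhds).and self_mem_nhdsWithin).exists
  have hs0 : 0 < s := hs0
  exact Set.mem_iUnion₂.mpr ⟨s⁻¹, inv_pos.mpr hs0, s • z, hs, inv_smul_smul₀ hs0.ne' z⟩

theorem diffCone_mono {X : Type*} [AddCommGroup X] [Module ℝ X] {A A' B B' : Set X}
    (hA : A ⊆ A') (hB : B ⊆ B') : diffCone A B ⊆ diffCone A' B' :=
  Set.iUnion₂_mono fun _ _ => Set.smul_set_mono (Set.sub_subset_sub hA hB)

section Range

variable {E : Type*} [NormedAddCommGroup E] [NormedSpace ℝ E] {S : Multi E (StrongDual ℝ E)}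

theorem snd_image_effDom_fitz {A : Set (E × StrongDual ℝ E)} (hA : A.Nonempty) :
    Prod.snd '' effDom (fitz A) = (fun p => p.1.2) '' fitzEpi A := by
  ext y
  constructor
  · rintro ⟨b, hb, rfl⟩
    obtain ⟨s, hs⟩ := (mem_effDom_fitz_iff hA).mp hb
    exact ⟨_, hs, rfl⟩
  · rintro ⟨⟨b, s⟩, hp, rfl⟩
    exact ⟨b, (mem_effDom_fitz_iff hA).mpr ⟨s, hp⟩, rfl⟩

theorem range_subset_snd_image_effDom_fitz (hm : S.IsMonotone) :
    S.range ⊆ Prod.snd '' effDom (fitz S.graph) := by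
  rintro y ⟨x, hx⟩
  have hx : (x, y) ∈ S.graph := hx
  exact ⟨(x, y), (mem_effDom_fitz_iff ⟨_, hx⟩).mpr ⟨_, mem_fitzEpi_of_mem hm hx⟩, rfl⟩

end Range

theorem theorem8p8 {E : Type*} [NormedAddCommGroup E] [NormedSpace ℝ E] [CompleteSpace E]
    [Nontrivial E] (S T : Multi E (StrongDual ℝ E))
    (hSc : S.Closed) (hSm : S.IsMonotone) (hSq : S.Quasidense)
    (hTc : T.Closed) (hTm : T.IsMonotone) (hTq : T.Quasidense) :
    -- (a) implies (b)
    (((S.range ∩ interior T.range).Nonempty ∨ (interior S.range ∩ T.range).Nonempty) →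
      diffCone S.range T.range = Set.univ) ∧
    -- (b) implies (c)
    (diffCone S.range T.range = Set.univ →
      IsClosedSubspace (diffCone (Prod.snd '' effDom (fitz S.graph))
        (Prod.snd '' effDom (fitz T.graph)))) ∧
    -- (c) implies (d)
    (IsClosedSubspace (diffCone (Prod.snd '' effDom (fitz S.graph))
        (Prod.snd '' effDom (fitz T.graph))) →
      (S.extendedParallelSum T).Closed ∧ (S.extendedParallelSum T).IsMonotone ∧
        (S.extendedParallelSum T).StablyQuasidense) ∧
    -- (d) implies (e)
    (((S.extendedParallelSum T).Closed ∧ (S.extendedParallelSum T).IsMonotone ∧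
        (S.extendedParallelSum T).StablyQuasidense) →
      fitzExt T.graph = mapL '' T.graph →
      (S.parallelSum T).Closed ∧ (S.parallelSum T).IsMonotone ∧
        (S.parallelSum T).StablyQuasidense) := by
  refine ⟨diffCone_eq_univ_of_interior, fun h => ?_, fun h => ?_, fun h hT => ?_⟩
  · have huniv : diffCone (Prod.snd '' effDom (fitz S.graph))
        (Prod.snd '' effDom (fitz T.graph)) = Set.univ :=
      Set.univ_subset_iff.mp (h ▸ diffCone_mono (range_subset_snd_image_effDom_fitz hSm)
        (range_subset_snd_image_effDom_fitz hTm))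
    rw [huniv]
    exact ⟨isClosed_univ, ⊤, Submodule.top_coe⟩
  · rw [snd_image_effDom_fitz (IsQuasidenseSet.nonempty hSq),
      snd_image_effDom_fitz (IsQuasidenseSet.nonempty hTq)] at h
    have hrep := isRepresentative_partialEpiSum (isRepresentative_fitzEpi hSm hSq)
      isClosed_fitzEpi (isRepresentative_fitzEpi hTm hTq) isClosed_fitzEpi h
    rw [Multi.Closed, Multi.IsMonotone, Multi.StablyQuasidense,
      graph_extendedParallelSum hSm hSq hTm hTq h]
    exact ⟨IsRepresentative.isClosed_dualCoincidence, fun a ha b hb => hrep.qForm_sub_nonneg ha hb,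
      hrep.isStablyQuasidenseSet_dualCoincidence⟩
  · rwa [← extendedParallelSum_eq_parallelSum hSc hSm hSq hT]
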